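/- Let $1\le\alpha\in\mathbb R$ and let $\ell\ge 0$ be an integer with $\ell\le\lfloor\alpha-\frac12\rfloor$. For real $x$ put $$p(x)=\sum_{k=0}^{\ell}\binom{\alpha+\ell}{k}x^k(1-x)^{\ell-k},\qquad \binom{\alpha+\ell}{k}=\frac{\Gamma(\alpha+\ell+1)}{\Gamma(k+1)\,\Gamma(\alpha+\ell-k+1)},$$ let $H_0(\gamma)=(\cos^2\pi\gamma)^{\alpha}\,p(\sin^2\pi\gamma)$ for $\gamma\in\mathbb R$, and let $\kappa=\log_2 p(\tfrac34)$ and $s=2\alpha-\kappa-1$. With the Fourier transform normalized as $\widehat f(\gamma)=\int_{\mathbb R}f(t)e^{-2\pi i t\gamma}\,dt$ (and extended to $L^2(\mathbb R)$), let $\varphi\in L^2(\mathbb R)$ be the fractional pseudo-spline of order $(\alpha,\ell)$, that is, the $L^2$-limit, as $m\to\infty$, of the functions $\varphi_m\in L^2(\mathbb R)$ with $$\widehat{\varphi}_m(\gamma)=\chi_{[-2^{m-1},2^{m-1}]}(\gamma)\prod_{j=1}^{m}H_0(2^{-j}\gamma).$$ Then the pointwise limit $\widehat\varphi(\gamma)=\lim_{m\to\infty}\widehat\varphi_m(\gamma)$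 exists for every $\gamma\in\mathbb R$, it represents the Fourier transform of $\varphi$, and there is a constant $c>0$ such that $$|\widehat\varphi(\gamma)|\le c\,(1+|\gamma|)^{-2\alpha+\kappa}\qquad\text{for all }\gamma\in\mathbb R.$$ Moreover $s>0$, and $\varphi\in C^{s-\varepsilon}(\mathbb R)$ for every $\varepsilon$ with $0<\varepsilon\le s$ (after modification of $\varphi$ on a null set, the same for all $\varepsilon$). Here, for $r\ge 0$ and $n=\lfloor r\rfloor$, $C^r(\mathbb R)$ is the Hölder space of the $n$ times continuously differentiable functions whose derivatives up to order $n$ are bounded and whose $n$-th derivative is uniformly Hölder continuous with exponent $r-n$. -/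

import Mathlib

open MeasureTheory Filter Topology FourierTransform

noncomputable section

namespace FracPseudoSpline

/-- The generalized binomial coefficient `Γ(x+1) / (Γ(k+1) Γ(x-k+1))`. -/
def gbinom (x : ℝ) (k : ℕ) : ℝ :=
  Real.Gamma (x + 1) / (Real.Gamma (k + 1) * Real.Gamma (x - k + 1))

/-- The polynomial `p(x) = ∑_{k=0}^ℓ binom(α+ℓ, k) x^k (1-x)^(ℓ-k)`. -/
def poly (α : ℝ) (ℓ : ℕ) (x : ℝ) : ℝ :=
  ∑ k ∈ Finset.range (ℓ + 1), gbinom (α + ℓ) k * x ^ k * (1 - x) ^ (ℓ - k)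

/-- The filter `H₀(γ) = (cos² πγ)^α ∑_{k=0}^ℓ binom(α+ℓ, k) (sin² πγ)^k (cos² πγ)^(ℓ-k)`. -/
def filt (α : ℝ) (ℓ : ℕ) (γ : ℝ) : ℝ :=
  (Real.cos (Real.pi * γ) ^ 2) ^ α *
    ∑ k ∈ Finset.range (ℓ + 1),
      gbinom (α + ℓ) k * (Real.sin (Real.pi * γ) ^ 2) ^ k * (Real.cos (Real.pi * γ) ^ 2) ^ (ℓ - k)

/-- The `m`-th step of the cascade algorithm on the Fourier side:
`χ_{[-2^(m-1), 2^(m-1)]}(γ) ∏_{j=1}^m H₀(2^(-j) γ)`. -/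
def cascadeHat (α : ℝ) (ℓ m : ℕ) : ℝ → ℂ :=
  Set.indicator (Set.Icc (-((2 : ℝ) ^ m / 2)) ((2 : ℝ) ^ m / 2))
    (fun γ => ((∏ j ∈ Finset.Icc 1 m, filt α ℓ (γ / 2 ^ j) : ℝ) : ℂ))

theorem continuous_filt {α : ℝ} (ℓ : ℕ) (hα : 1 ≤ α) : Continuous (filt α ℓ) := by
  unfold filt
  refine Continuous.mul ?_ (by fun_prop)
  exact Continuous.rpow_const (by fun_prop) (fun _ => Or.inr (by linarith))

theorem memLp_cascadeHat {α : ℝ} (ℓ : ℕ) (hα : 1 ≤ α) (m : ℕ) :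
    MemLp (cascadeHat α ℓ m) 2 (volume : Measure ℝ) := by
  have hc : Continuous (fun γ : ℝ => ((∏ j ∈ Finset.Icc 1 m, filt α ℓ (γ / 2 ^ j) : ℝ) : ℂ)) := by
    refine Complex.continuous_ofReal.comp (continuous_finsetProd _ fun j _ => ?_)
    exact (continuous_filt ℓ hα).comp (by fun_prop)
  unfold cascadeHat
  rw [memLp_indicator_iff_restrict measurableSet_Icc]
  obtain ⟨C, hC⟩ := (isCompact_Icc (a := -((2 : ℝ) ^ m / 2)) (b := (2 : ℝ) ^ m / 2)).exists_bound_of_continuousOn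
    hc.continuousOn
  refine MemLp.of_bound hc.aestronglyMeasurable C ?_
  exact (ae_restrict_iff' measurableSet_Icc).2 (ae_of_all _ hC)

/-- The `m`-th cascade iterate in `L²(ℝ)`: the inverse Fourier transform of `cascadeHat α ℓ m`
(Mathlib's normalization of the Fourier transform uses the kernel `exp(-2πi t γ)`). -/
def cascade {α : ℝ} (ℓ : ℕ) (hα : 1 ≤ α) (m : ℕ) : Lp ℂ 2 (volume : Measure ℝ) :=
  𝓕⁻ ((memLp_cascadeHat ℓ hα m).toLp (cascadeHat α ℓ m))

/-- `φ ∈ L²(ℝ)` is the fractional pseudo-spline of order `(α, ℓ)`: the `L²`-limit of the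
cascade algorithm. -/
def IsPseudoSpline {α : ℝ} (ℓ : ℕ) (hα : 1 ≤ α) (φ : Lp ℂ 2 (volume : Measure ℝ)) : Prop :=
  Tendsto (fun m => cascade ℓ hα m) atTop (𝓝 φ)

/-- The Hölder space `C^r(ℝ)`, `r ≥ 0`: with `n = ⌊r⌋`, the function is `n` times continuously
differentiable, its derivatives up to order `n` are bounded, and the `n`-th derivative is uniformly
Hölder continuous with exponent `r - n` (nothing new if `r = n`). -/
def IsHolder (r : ℝ) (g : ℝ → ℂ) : Prop :=
  ContDiff ℝ (⌊r⌋₊ : ℕ) g ∧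
  (∀ k ≤ ⌊r⌋₊, ∃ B : ℝ, ∀ x, ‖iteratedDeriv k g x‖ ≤ B) ∧
  ∃ K : ℝ, ∀ x y,
    ‖iteratedDeriv ⌊r⌋₊ g x - iteratedDeriv ⌊r⌋₊ g y‖ ≤ K * |x - y| ^ (r - ⌊r⌋₊)

/-- The exponent `κ = log₂ p(3/4)`. -/
def kappa (α : ℝ) (ℓ : ℕ) : ℝ := Real.logb 2 (poly α ℓ (3 / 4))

end FracPseudoSpline

end

/-! The polynomial `p` is the binomial series of `(1-x)^(-α)` truncated after degree `ℓ`, so its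
coefficients are positive. The product of filters splits into a cosine product, which telescopes to
a sine quotient and decays like `|γ|^(-2α)`, and a product of values `p(sin²)`, which grows at most
like `|γ|^κ`. For the growth, `y ↦ 4y(1-y)` takes `sin²` of an angle to `sin²` of its double and
fixes `3/4`. A factor with `y ≤ 3/4` is at most `p(3/4)`; one with `y ≥ 3/4` is paired with its
neighbour by `poly_mul_poly_le`. About `log₂(1+|γ|)` factors matter; the rest converge
geometrically. The bound is uniform in `m`, hence passes to the limit. Since `p(3/4) < 2^(2α-1)`
(`poly_three_quarters_lt`), the limit is integrable, and its moments of order below `s` give the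
Hölder regularity of its inverse transform. -/

namespace FracPseudoSpline

/-! ### The polynomial as a truncated binomial series. -/

/-- The coefficients of the binomial series of `(1 - x)^(-α)`. -/
noncomputable def negBinom (α : ℝ) (k : ℕ) : ℝ :=
  Real.Gamma (α + k) / (Real.Gamma (k + 1) * Real.Gamma α)

theorem negBinom_zero {α : ℝ} (hα : 0 < α) : negBinom α 0 = 1 := by
  have := (Real.Gamma_pos_of_pos hα).ne'
  simp [negBinom, this]

theorem negBinom_pos {α : ℝ} (hα : 0 < α) (k : ℕ) : 0 < negBinom α k := by
  unfold negBinom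
  have h1 := Real.Gamma_pos_of_pos hα
  have h2 : 0 < Real.Gamma (α + k) := Real.Gamma_pos_of_pos (by positivity)
  have h3 : 0 < Real.Gamma ((k : ℝ) + 1) := Real.Gamma_pos_of_pos (by positivity)
  positivity

theorem negBinom_succ {α : ℝ} (hα : 0 < α) (k : ℕ) :
    ((k : ℝ) + 1) * negBinom α (k + 1) = (α + k) * negBinom α k := by
  unfold negBinom
  have h1 := (Real.Gamma_pos_of_pos hα).ne'
  have hk : (0 : ℝ) < (k : ℝ) + 1 := by positivity
  have h3 := (Real.Gamma_pos_of_pos hk).ne'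
  have e1 : Real.Gamma (α + ((k + 1 : ℕ) : ℝ)) = (α + k) * Real.Gamma (α + k) := by
    rw [← Real.Gamma_add_one (by positivity)]; push_cast; ring_nf
  have e2 : Real.Gamma (((k + 1 : ℕ) : ℝ) + 1) = ((k : ℝ) + 1) * Real.Gamma ((k : ℝ) + 1) := by
    rw [← Real.Gamma_add_one hk.ne']; push_cast; rfl
  rw [e1, e2]
  field_simp

theorem gbinom_zero_right {x : ℝ} (hx : 0 ≤ x) : gbinom x 0 = 1 := by
  have := (Real.Gamma_pos_of_pos (show 0 < x + 1 by linarith)).ne'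
  simp [gbinom, this]

theorem gbinom_succ_succ {x : ℝ} {k : ℕ} (h : (k : ℝ) < x) :
    gbinom (x + 1) (k + 1) = gbinom x (k + 1) + gbinom x k := by
  unfold gbinom
  have hk : (0 : ℝ) < (k : ℝ) + 1 := by positivity
  have hx : 0 < x + 1 := by linarith
  have hd : 0 < x - k := by linarith
  have h1 := (Real.Gamma_pos_of_pos hk).ne'
  have h2 := (Real.Gamma_pos_of_pos hd).ne'
  have e1 : Real.Gamma (x + 1 + 1) = (x + 1) * Real.Gamma (x + 1) := Real.Gamma_add_one hx.ne'
  have e2 : Real.Gamma (((k + 1 : ℕ) : ℝ) + 1) = ((k : ℝ) + 1) * Real.Gamma ((k : ℝ) + 1) := by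
    rw [← Real.Gamma_add_one hk.ne']; push_cast; rfl
  have e3 : Real.Gamma (x - k + 1) = (x - k) * Real.Gamma (x - k) := Real.Gamma_add_one hd.ne'
  have e4 : x + 1 - ((k + 1 : ℕ) : ℝ) + 1 = x - k + 1 := by push_cast; ring
  have e5 : x - ((k + 1 : ℕ) : ℝ) + 1 = x - k := by push_cast; ring
  rw [e4, e5, e1, e2, e3]
  field_simp
  ring

/-- Pascal's rule gives `x * poly α ℓ x` plus a sum with the old binomials; that sum is `(1 - x) *
poly α ℓ x` plus a top term, and the weights add to 1. -/
theorem poly_succ {α : ℝ} (hα : 0 < α) (ℓ : ℕ) (x : ℝ) :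
    poly α (ℓ + 1) x = poly α ℓ x + negBinom α (ℓ + 1) * x ^ (ℓ + 1) := by
  have hcast : α + ((ℓ + 1 : ℕ) : ℝ) = α + ℓ + 1 := by push_cast; ring
  have h0 : (0 : ℝ) ≤ α + ℓ := by positivity
  have hlast : gbinom (α + ℓ) (ℓ + 1) = negBinom α (ℓ + 1) := by
    unfold gbinom negBinom
    have e1 : α + ℓ + 1 = α + ((ℓ + 1 : ℕ) : ℝ) := hcast.symm
    have e2 : α + (ℓ : ℝ) - ((ℓ + 1 : ℕ) : ℝ) + 1 = α := by push_cast; ring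
    rw [e1, e2]
  have hA : ∑ k ∈ Finset.range (ℓ + 1 + 1), gbinom (α + ℓ) k * x ^ k * (1 - x) ^ (ℓ + 1 - k)
      = (1 - x) * poly α ℓ x + negBinom α (ℓ + 1) * x ^ (ℓ + 1) := by
    rw [Finset.sum_range_succ, hlast, poly, Finset.mul_sum]
    congr 1
    · refine Finset.sum_congr rfl fun k hk => ?_
      have : ℓ + 1 - k = (ℓ - k) + 1 := by have := Finset.mem_range.1 hk; omega
      rw [this, pow_succ]; ring
    · simp
  have hB : poly α (ℓ + 1) x = x * poly α ℓ x +
      ∑ k ∈ Finset.range (ℓ + 1 + 1), gbinom (α + ℓ) k * x ^ k * (1 - x) ^ (ℓ + 1 - k) := by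
    rw [poly, Finset.sum_range_succ', Finset.sum_range_succ' (n := ℓ + 1), hcast,
      gbinom_zero_right (by linarith), gbinom_zero_right h0, poly, Finset.mul_sum, ← add_assoc,
      ← Finset.sum_add_distrib]
    congr 1
    refine Finset.sum_congr rfl fun k hk => ?_
    have hk' : (k : ℝ) ≤ ℓ := by exact_mod_cast Nat.lt_succ_iff.1 (Finset.mem_range.1 hk)
    rw [gbinom_succ_succ (by linarith), Nat.add_sub_add_right, pow_succ]
    ring
  rw [hB, hA]; ring

theorem poly_eq_sum_negBinom {α : ℝ} (hα : 0 < α) (ℓ : ℕ) (x : ℝ) :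
    poly α ℓ x = ∑ k ∈ Finset.range (ℓ + 1), negBinom α k * x ^ k := by
  induction ℓ with
  | zero => simp [poly, gbinom_zero_right hα.le, negBinom_zero hα]
  | succ n ih => rw [poly_succ hα, ih, Finset.sum_range_succ _ (n + 1)]

theorem one_le_poly {α : ℝ} (hα : 0 < α) (ℓ : ℕ) {x : ℝ} (hx : 0 ≤ x) : 1 ≤ poly α ℓ x := by
  rw [poly_eq_sum_negBinom hα, Finset.sum_range_succ', negBinom_zero hα]
  have : 0 ≤ ∑ k ∈ Finset.range ℓ, negBinom α (k + 1) * x ^ (k + 1) :=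
    Finset.sum_nonneg fun k _ => mul_nonneg (negBinom_pos hα _).le (by positivity)
  simpa using this

theorem poly_mono {α : ℝ} (hα : 0 < α) (ℓ : ℕ) {x y : ℝ} (hx : 0 ≤ x) (hxy : x ≤ y) :
    poly α ℓ x ≤ poly α ℓ y := by
  simp only [poly_eq_sum_negBinom hα]
  exact Finset.sum_le_sum fun k _ =>
    mul_le_mul_of_nonneg_left (pow_le_pow_left₀ hx hxy k) (negBinom_pos hα k).le

theorem poly_le_one_add {α : ℝ} (hα : 0 < α) (ℓ : ℕ) {x : ℝ} (hx : 0 ≤ x) (hx1 : x ≤ 1) :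
    poly α ℓ x ≤ 1 + poly α ℓ 1 * x := by
  rw [poly_eq_sum_negBinom hα, poly_eq_sum_negBinom hα, Finset.sum_range_succ',
    Finset.sum_range_succ' (fun k => negBinom α k * 1 ^ k), negBinom_zero hα]
  have : ∑ k ∈ Finset.range ℓ, negBinom α (k + 1) * x ^ (k + 1) ≤
      (∑ k ∈ Finset.range ℓ, negBinom α (k + 1) * 1 ^ (k + 1)) * x := by
    rw [Finset.sum_mul]
    refine Finset.sum_le_sum fun k _ => ?_
    rw [one_pow, mul_one]
    refine mul_le_mul_of_nonneg_left ?_ (negBinom_pos hα _).le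
    simpa using pow_le_pow_of_le_one hx hx1 (Nat.le_add_left 1 k)
  simp only [pow_zero, mul_one]
  nlinarith

/-! ### Inequalities for the polynomial and its derivative. -/

/-- The derivative of `poly`. -/
noncomputable def polyDeriv (α : ℝ) (ℓ : ℕ) (x : ℝ) : ℝ :=
  ∑ k ∈ Finset.range ℓ, (α + k) * negBinom α k * x ^ k

theorem polyDeriv_nonneg {α : ℝ} (hα : 0 < α) (ℓ : ℕ) {x : ℝ} (hx : 0 ≤ x) :
    0 ≤ polyDeriv α ℓ x :=
  Finset.sum_nonneg fun k _ => by have := negBinom_pos hα k; positivity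

theorem hasDerivAt_poly {α : ℝ} (hα : 0 < α) (ℓ : ℕ) (x : ℝ) :
    HasDerivAt (poly α ℓ) (polyDeriv α ℓ x) x := by
  induction ℓ with
  | zero =>
    have : poly α 0 = fun _ => 1 := by
      ext y; simp [poly_eq_sum_negBinom hα, negBinom_zero hα]
    rw [this]
    simpa [polyDeriv] using hasDerivAt_const x (1 : ℝ)
  | succ n ih =>
    have : poly α (n + 1) = fun y => poly α n y + negBinom α (n + 1) * y ^ (n + 1) := by
      ext y; exact poly_succ hα n y
    rw [this]
    refine (ih.add ((hasDerivAt_pow (n + 1) x).const_mul (negBinom α (n + 1)))).congr_deriv ?_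
    have e : polyDeriv α (n + 1) x = polyDeriv α n x + (α + n) * negBinom α n * x ^ n :=
      Finset.sum_range_succ _ _
    rw [e, ← negBinom_succ hα]
    push_cast
    ring

theorem mul_polyDeriv_le {α : ℝ} (hα : 0 < α) (ℓ : ℕ) {x : ℝ} (hx : 0 ≤ x) :
    x * polyDeriv α ℓ x ≤ ℓ * poly α ℓ x := by
  rw [poly_eq_sum_negBinom hα, Finset.sum_range_succ', negBinom_zero hα, polyDeriv,
    Finset.mul_sum, mul_add, Finset.mul_sum]
  have : ∑ k ∈ Finset.range ℓ, x * ((α + k) * negBinom α k * x ^ k) ≤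
      ∑ k ∈ Finset.range ℓ, (ℓ : ℝ) * (negBinom α (k + 1) * x ^ (k + 1)) := by
    refine Finset.sum_le_sum fun k hk => ?_
    have hk' : (k : ℝ) + 1 ≤ ℓ := by exact_mod_cast Finset.mem_range.1 hk
    have hb := negBinom_pos hα (k + 1)
    rw [← negBinom_succ hα]
    calc x * (((k : ℝ) + 1) * negBinom α (k + 1) * x ^ k)
        = ((k : ℝ) + 1) * (negBinom α (k + 1) * x ^ (k + 1)) := by ring
      _ ≤ _ := by gcongr
  have : (0 : ℝ) ≤ ℓ * (1 * x ^ 0) := by positivity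
  linarith

/-- The full series satisfies `(1-x)q' = αq`; the last term is the truncation error. -/
theorem one_sub_mul_polyDeriv {α : ℝ} (hα : 0 < α) (ℓ : ℕ) (x : ℝ) :
    (1 - x) * polyDeriv α ℓ x = α * poly α ℓ x - (α + ℓ) * negBinom α ℓ * x ^ ℓ := by
  induction ℓ with
  | zero => simp [polyDeriv, poly_eq_sum_negBinom hα]
  | succ n ih =>
    have e : polyDeriv α (n + 1) x = polyDeriv α n x + (α + n) * negBinom α n * x ^ n :=
      Finset.sum_range_succ _ _
    rw [e, mul_add, ih, poly_succ hα]
    have := negBinom_succ hα n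
    push_cast
    linear_combination x ^ (n + 1) * this

theorem le_polyDeriv {α : ℝ} {ℓ : ℕ} (hα : 1 ≤ α) (hℓ : (ℓ : ℝ) ≤ α - 1 / 2) {x : ℝ} (hx : 0 ≤ x)
    (hx' : x ≤ 3 / 4) : 2 / 3 * ℓ * poly α ℓ x ≤ polyDeriv α ℓ x := by
  have hα0 : 0 < α := by linarith
  cases ℓ with
  | zero => simpa using polyDeriv_nonneg hα0 0 hx
  | succ n =>
    push_cast at hℓ
    rw [poly_succ hα0, poly_eq_sum_negBinom hα0, polyDeriv, Finset.sum_range_succ,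
      Finset.sum_range_succ]
    have h1 : 2 / 3 * ((n : ℝ) + 1) * ∑ k ∈ Finset.range n, negBinom α k * x ^ k ≤
        ∑ k ∈ Finset.range n, (α + k) * negBinom α k * x ^ k := by
      rw [Finset.mul_sum]
      refine Finset.sum_le_sum fun k _ => ?_
      have hb := negBinom_pos hα0 k
      rw [mul_assoc (α + k)]
      have : (0 : ℝ) ≤ k := Nat.cast_nonneg k
      have : (0 : ℝ) ≤ n := Nat.cast_nonneg n
      have : 2 / 3 * ((n : ℝ) + 1) ≤ α + k := by linarith
      gcongr
    -- The two top terms of `p` share the last term of `p'`. As `x ≤ 3/4`, it suffices that `2/3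
    -- (n+1) ≤ (α+n)/2`, which `α ≥ n + 3/2` provides.
    have h2 : 2 / 3 * ((n : ℝ) + 1) *
        (negBinom α n * x ^ n + negBinom α (n + 1) * x ^ (n + 1)) ≤
        (α + n) * negBinom α n * x ^ n := by
      have hb : 0 ≤ negBinom α n * x ^ n := mul_nonneg (negBinom_pos hα0 n).le (by positivity)
      have e : 2 / 3 * ((n : ℝ) + 1) * (negBinom α n * x ^ n + negBinom α (n + 1) * x ^ (n + 1))
          = (2 / 3 * ((n : ℝ) + 1) + 2 / 3 * x * (α + n)) * (negBinom α n * x ^ n) := by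
        linear_combination (2 / 3 * x ^ (n + 1)) * negBinom_succ hα0 n
      rw [e, mul_assoc (α + n)]
      have hn : (0 : ℝ) ≤ n := Nat.cast_nonneg n
      refine mul_le_mul_of_nonneg_right ?_ hb
      nlinarith [mul_le_mul_of_nonneg_right hx' (show (0 : ℝ) ≤ α + n by positivity)]
    push_cast
    linarith

/-- The left side decreases on `[3/4, 1]`, with equality at the fixed point `3/4`: the logarithmic
derivative of `p` is at most `ℓ/y` at `y` and at least `2ℓ/3` at `4y(1-y)`. -/
theorem poly_mul_poly_le {α : ℝ} {ℓ : ℕ} (hα : 1 ≤ α) (hℓ : (ℓ : ℝ) ≤ α - 1 / 2) {y : ℝ}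
    (hy : 3 / 4 ≤ y) (hy1 : y ≤ 1) :
    poly α ℓ y * poly α ℓ (4 * y * (1 - y)) ≤ poly α ℓ (3 / 4) ^ 2 := by
  have hα0 : 0 < α := by linarith
  have hd : ∀ y : ℝ, HasDerivAt (fun y => poly α ℓ y * poly α ℓ (4 * y * (1 - y)))
      (polyDeriv α ℓ y * poly α ℓ (4 * y * (1 - y)) +
        poly α ℓ y * (polyDeriv α ℓ (4 * y * (1 - y)) * (4 - 8 * y))) y := by
    intro y
    have hz : HasDerivAt (fun y : ℝ => 4 * y * (1 - y)) (4 - 8 * y) y := by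
      refine (((hasDerivAt_id y).const_mul 4).mul ((hasDerivAt_id y).const_sub 1)).congr_deriv ?_
      simp only [id]
      ring
    exact (hasDerivAt_poly hα0 ℓ y).mul ((hasDerivAt_poly hα0 ℓ _).comp y hz)
  have hanti : AntitoneOn (fun y => poly α ℓ y * poly α ℓ (4 * y * (1 - y)))
      (Set.Icc (3 / 4) 1) := by
    refine antitoneOn_of_deriv_nonpos (convex_Icc _ _)
      (fun y _ => (hd y).continuousAt.continuousWithinAt)
      (fun y _ => (hd y).differentiableAt.differentiableWithinAt) fun y hy => ?_
    rw [interior_Icc] at hy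
    obtain ⟨h1, h2⟩ := hy
    rw [(hd y).deriv]
    have hz0 : 0 ≤ 4 * y * (1 - y) := by nlinarith
    have hz1 : 4 * y * (1 - y) ≤ 3 / 4 := by nlinarith
    have hy0 : 0 < y := by linarith
    set z := 4 * y * (1 - y)
    have hpy := one_le_poly hα0 ℓ hy0.le
    have hpz := one_le_poly hα0 ℓ hz0
    have a1 := mul_polyDeriv_le hα0 ℓ hy0.le
    have a2 := le_polyDeriv hα hℓ hz0 hz1
    have hl : (0 : ℝ) ≤ ℓ := Nat.cast_nonneg ℓ
    have b1 : y * polyDeriv α ℓ y * poly α ℓ z ≤ ℓ * poly α ℓ y * poly α ℓ z :=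
      mul_le_mul_of_nonneg_right a1 (by linarith)
    have b2 : (y * (8 * y - 4) * poly α ℓ y) * (2 / 3 * ℓ * poly α ℓ z) ≤
        (y * (8 * y - 4) * poly α ℓ y) * polyDeriv α ℓ z :=
      mul_le_mul_of_nonneg_left a2
        (mul_nonneg (mul_nonneg hy0.le (by linarith)) (by linarith))
    -- `y(8y-4)·2/3` equals 1 at `y = 3/4`, so the constant `2/3` just suffices.
    have b3 : 0 ≤ (y * (8 * y - 4) * (2 / 3) - 1) * (ℓ * poly α ℓ y * poly α ℓ z) :=
      mul_nonneg (by nlinarith) (mul_nonneg (mul_nonneg hl (by linarith)) (by linarith))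
    have key : y * (polyDeriv α ℓ y * poly α ℓ z +
        poly α ℓ y * (polyDeriv α ℓ z * (4 - 8 * y))) ≤ 0 := by linarith
    by_contra hcon
    exact absurd key (not_le.2 (mul_pos hy0 (not_le.1 hcon)))
  have := hanti (Set.left_mem_Icc.2 (by norm_num)) ⟨hy, hy1⟩ hy
  refine this.trans (le_of_eq ?_)
  norm_num
  ring

theorem poly_mul_rpow_le_one {α : ℝ} (hα : 1 ≤ α) (ℓ : ℕ) {x : ℝ} (hx : 0 ≤ x) (hx1 : x ≤ 1) :
    (1 - x) ^ α * poly α ℓ x ≤ 1 := by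
  have hα0 : 0 < α := by linarith
  have hd : ∀ y : ℝ, HasDerivAt (fun y => (1 - y) ^ α * poly α ℓ y)
      (-1 * α * (1 - y) ^ (α - 1) * poly α ℓ y + (1 - y) ^ α * polyDeriv α ℓ y) y := by
    intro y
    exact (((hasDerivAt_id y).const_sub 1).rpow_const (Or.inr hα)).mul (hasDerivAt_poly hα0 ℓ y)
  have hanti : AntitoneOn (fun y => (1 - y) ^ α * poly α ℓ y) (Set.Icc 0 1) := by
    refine antitoneOn_of_deriv_nonpos (convex_Icc _ _)
      (fun y _ => (hd y).continuousAt.continuousWithinAt)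
      (fun y _ => (hd y).differentiableAt.differentiableWithinAt) fun y hy => ?_
    rw [interior_Icc] at hy
    obtain ⟨h1, h2⟩ := hy
    have h3 : 0 < 1 - y := by linarith
    have e : (1 - y) ^ α = (1 - y) ^ (α - 1) * (1 - y) := by
      rw [← Real.rpow_add_one h3.ne']; ring_nf
    have hb := negBinom_pos hα0 ℓ
    have hr := Real.rpow_nonneg h3.le (α - 1)
    have : 0 ≤ (1 - y) ^ (α - 1) * ((α + ℓ) * negBinom α ℓ * y ^ ℓ) := by positivity
    rw [(hd y).deriv, e]
    linear_combination this + (1 - y) ^ (α - 1) * one_sub_mul_polyDeriv hα0 ℓ y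
  have := hanti (Set.left_mem_Icc.2 (by norm_num)) ⟨hx, hx1⟩ hx
  refine this.trans (le_of_eq ?_)
  have : poly α ℓ 0 = 1 := by
    rw [poly_eq_sum_negBinom hα0, Finset.sum_range_succ', negBinom_zero hα0]
    simp
  simp [this]

/-! ### The size of `p(3/4)` and the exponent `κ`. -/

theorem poly_three_quarters_lt {α : ℝ} {ℓ : ℕ} (hα : 1 ≤ α) (hℓ : (ℓ : ℝ) ≤ α - 1 / 2) :
    poly α ℓ (3 / 4) < 2 ^ (2 * α - 1) := by
  have hα0 : 0 < α := by linarith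
  have e4 : (2 : ℝ) ^ (2 * α - 1) = 4 ^ α / 2 := by
    rw [Real.rpow_sub_one (by norm_num), Real.rpow_mul (by norm_num)]; norm_num
  rw [e4]
  rcases Nat.lt_or_ge ℓ 2 with h2 | h2
  -- Bernoulli's inequality settles degrees 0 and 1.
  · have hb : 1 + α * 3 ≤ (4 : ℝ) ^ α := by
      have := one_add_mul_self_le_rpow_one_add (s := 3) (by norm_num) hα
      norm_num at this; exact this
    have h1 := negBinom_succ hα0 0
    rw [negBinom_zero hα0] at h1
    norm_num at h1
    interval_cases ℓ
    · rw [poly_eq_sum_negBinom hα0]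
      simp [negBinom_zero hα0]
      linarith
    · rw [poly_eq_sum_negBinom hα0]
      simp [Finset.sum_range_succ, negBinom_zero hα0, h1]
      norm_num at hℓ
      linarith
  · have h2' : (2 : ℝ) ≤ ℓ := by exact_mod_cast h2
    have hhalf : poly α ℓ (1 / 2) ≤ 2 ^ α := by
      have := poly_mul_rpow_le_one hα ℓ (x := 1 / 2) (by norm_num) (by norm_num)
      have e : (1 - 1 / 2 : ℝ) ^ α = ((2 : ℝ) ^ α)⁻¹ := by
        rw [← Real.inv_rpow (by norm_num)]; norm_num
      rw [e] at this
      have hp : (0 : ℝ) < 2 ^ α := by positivity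
      rwa [inv_mul_le_iff₀ hp, mul_one] at this
    have hcmp : poly α ℓ (3 / 4) ≤ (3 / 2) ^ ℓ * poly α ℓ (1 / 2) := by
      rw [poly_eq_sum_negBinom hα0, poly_eq_sum_negBinom hα0, Finset.mul_sum]
      refine Finset.sum_le_sum fun k hk => ?_
      have hk' := Nat.lt_succ_iff.1 (Finset.mem_range.1 hk)
      have hb := negBinom_pos hα0 k
      have e : (3 / 4 : ℝ) ^ k = (3 / 2) ^ k * (1 / 2) ^ k := by rw [← mul_pow]; norm_num
      rw [e]
      calc negBinom α k * ((3 / 2) ^ k * (1 / 2) ^ k)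
          = (3 / 2 : ℝ) ^ k * (negBinom α k * (1 / 2) ^ k) := by ring
        _ ≤ _ := by
          gcongr
          norm_num
    have hr : ((3 / 2 : ℝ) ^ ℓ) ≤ (3 / 2) ^ (α - 1 / 2) := by
      rw [← Real.rpow_natCast]
      exact Real.rpow_le_rpow_of_exponent_le (by norm_num) hℓ
    have hs : ((3 / 2 : ℝ) ^ (1 / 2 : ℝ)) * (3 / 2) ^ (1 / 2 : ℝ) = 3 / 2 := by
      rw [← Real.rpow_add (by norm_num)]; norm_num
    have hs0 : 0 < (3 / 2 : ℝ) ^ (1 / 2 : ℝ) := by positivity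
    rw [Real.rpow_sub (by norm_num)] at hr
    set t := (3 / 2 : ℝ) ^ (1 / 2 : ℝ)
    have h43 : (16 / 9 : ℝ) ≤ (4 / 3) ^ α := by
      calc (16 / 9 : ℝ) = (4 / 3) ^ (2 : ℝ) := by norm_num
        _ ≤ _ := Real.rpow_le_rpow_of_exponent_le (by norm_num) (by linarith)
    have e3 : (3 / 2 : ℝ) ^ α * 2 ^ α = 3 ^ α := by
      rw [← Real.mul_rpow (by norm_num) (by norm_num)]; norm_num
    have e4 : (4 / 3 : ℝ) ^ α * 3 ^ α = 4 ^ α := by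
      rw [← Real.mul_rpow (by norm_num) (by norm_num)]; norm_num
    have h3 : (0 : ℝ) < 3 ^ α := by positivity
    have hA : poly α ℓ (3 / 4) ≤ 3 ^ α / t := by
      have h0 : 0 ≤ poly α ℓ (1 / 2) := zero_le_one.trans (one_le_poly hα0 ℓ (by norm_num))
      calc poly α ℓ (3 / 4) ≤ (3 / 2) ^ ℓ * poly α ℓ (1 / 2) := hcmp
        _ ≤ ((3 / 2) ^ α / t) * 2 ^ α := by gcongr
        _ = _ := by rw [← e3]; ring
    refine hA.trans_lt ?_
    -- `9/8` is chosen because `16/9 · 9/8 = 2`.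
    have ht : 9 / 8 < t := by nlinarith
    rw [div_lt_iff₀ hs0, ← e4]
    have hBt : 2 < (4 / 3 : ℝ) ^ α * t := by
      nlinarith [mul_le_mul_of_nonneg_right h43 hs0.le]
    nlinarith [mul_lt_mul_of_pos_right hBt h3]

theorem kappa_nonneg {α : ℝ} (ℓ : ℕ) (hα : 1 ≤ α) : 0 ≤ kappa α ℓ :=
  Real.logb_nonneg (by norm_num) (one_le_poly (by linarith) ℓ (by norm_num))

theorem two_rpow_kappa {α : ℝ} (ℓ : ℕ) (hα : 1 ≤ α) :
    (2 : ℝ) ^ kappa α ℓ = poly α ℓ (3 / 4) :=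
  Real.rpow_logb (by norm_num) (by norm_num)
    (zero_lt_one.trans_le (one_le_poly (by linarith) ℓ (by norm_num)))

theorem kappa_lt {α : ℝ} {ℓ : ℕ} (hα : 1 ≤ α) (hℓ : (ℓ : ℝ) ≤ α - 1 / 2) :
    kappa α ℓ < 2 * α - 1 := by
  have h := poly_three_quarters_lt hα hℓ
  rw [← two_rpow_kappa ℓ hα] at h
  exact (Real.rpow_lt_rpow_left_iff (by norm_num)).1 h

/-! ### Bounds and convergence for the filter products. -/

theorem filt_eq (α : ℝ) (ℓ : ℕ) (γ : ℝ) :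
    filt α ℓ γ = (Real.cos (Real.pi * γ) ^ 2) ^ α * poly α ℓ (Real.sin (Real.pi * γ) ^ 2) := by
  have : Real.cos (Real.pi * γ) ^ 2 = 1 - Real.sin (Real.pi * γ) ^ 2 := by
    linarith [Real.sin_sq_add_cos_sq (Real.pi * γ)]
  rw [filt, poly, ← this]

theorem prod_filt_eq (α : ℝ) (ℓ m : ℕ) (γ : ℝ) :
    ∏ j ∈ Finset.Icc 1 m, filt α ℓ (γ / 2 ^ j) =
      (∏ j ∈ Finset.Icc 1 m, Real.cos (Real.pi * (γ / 2 ^ j)) ^ 2) ^ α *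
        ∏ j ∈ Finset.Icc 1 m, poly α ℓ (Real.sin (Real.pi * (γ / 2 ^ j)) ^ 2) := by
  simp only [filt_eq]
  rw [Finset.prod_mul_distrib, Real.finsetProd_rpow _ _ fun _ _ => sq_nonneg _]

theorem prod_cos_mul_sin (m : ℕ) (γ : ℝ) :
    (∏ j ∈ Finset.Icc 1 m, Real.cos (Real.pi * (γ / 2 ^ j))) *
      (2 ^ m * Real.sin (Real.pi * (γ / 2 ^ m))) = Real.sin (Real.pi * γ) := by
  induction m with
  | zero => simp
  | succ n ih =>
    have e : Real.pi * (γ / 2 ^ n) = 2 * (Real.pi * (γ / 2 ^ (n + 1))) := by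
      rw [pow_succ]; field_simp
    rw [e, Real.sin_two_mul] at ih
    rw [Finset.prod_Icc_succ_top (by omega), ← ih]
    ring

/-- The cutoff keeps `πγ/2^m` within `[-π/2, π/2]`, where Jordan's inequality bounds the telescoped
sine from below. -/
theorem prod_cos_sq_le {m : ℕ} {γ : ℝ} (hγ : |γ| ≤ 2 ^ m / 2) :
    ∏ j ∈ Finset.Icc 1 m, Real.cos (Real.pi * (γ / 2 ^ j)) ^ 2 ≤ (2 / (1 + |γ|)) ^ 2 := by
  rw [Finset.prod_pow]
  set C := ∏ j ∈ Finset.Icc 1 m, Real.cos (Real.pi * (γ / 2 ^ j)) with hC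
  have h1 : |C| ≤ 1 := by
    rw [hC, Finset.abs_prod]
    exact Finset.prod_le_one (fun _ _ => abs_nonneg _) fun _ _ => Real.abs_cos_le_one _
  have hp := Real.pi_pos
  have h2m : (0 : ℝ) < 2 ^ m := by positivity
  have e : |Real.pi * (γ / 2 ^ m)| = Real.pi * (|γ| / 2 ^ m) := by
    rw [abs_mul, abs_div, abs_of_pos hp, abs_of_pos h2m]
  have h2 : 2 / Real.pi * |Real.pi * (γ / 2 ^ m)| ≤ |Real.sin (Real.pi * (γ / 2 ^ m))| := by
    apply Real.mul_abs_le_abs_sin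
    rw [e, div_eq_mul_inv Real.pi 2]
    refine mul_le_mul_of_nonneg_left ?_ hp.le
    rw [div_le_iff₀ h2m]; linarith
  have h3 : |C| * (2 * |γ|) ≤ 1 := by
    calc |C| * (2 * |γ|) = |C| * (2 ^ m * (2 / Real.pi * |Real.pi * (γ / 2 ^ m)|)) := by
          rw [e]; field_simp
      _ ≤ |C| * (2 ^ m * |Real.sin (Real.pi * (γ / 2 ^ m))|) := by gcongr
      _ = |Real.sin (Real.pi * γ)| := by
          rw [← prod_cos_mul_sin m γ, abs_mul, abs_mul, abs_of_pos h2m]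
      _ ≤ 1 := Real.abs_sin_le_one _
  have h4 : |C| ≤ 2 / (1 + |γ|) := by
    rw [le_div_iff₀ (by positivity)]; linarith
  rw [← sq_abs C]
  exact pow_le_pow_left₀ (abs_nonneg _) h4 2

theorem one_le_poly_sin_sq {α : ℝ} (hα : 1 ≤ α) (ℓ : ℕ) (x : ℝ) :
    1 ≤ poly α ℓ (Real.sin x ^ 2) :=
  one_le_poly (by linarith) ℓ (sq_nonneg _)

theorem monotone_prod_poly {α : ℝ} (hα : 1 ≤ α) (ℓ : ℕ) (γ : ℝ) :
    Monotone fun m : ℕ =>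
      ∏ j ∈ Finset.Icc 1 m, poly α ℓ (Real.sin (Real.pi * (γ / 2 ^ j)) ^ 2) := by
  refine monotone_nat_of_le_succ fun m => ?_
  rw [Finset.prod_Icc_succ_top (by omega)]
  refine le_mul_of_one_le_right ?_ (one_le_poly_sin_sq hα ℓ _)
  exact Finset.prod_nonneg fun _ _ => zero_le_one.trans (one_le_poly_sin_sq hα ℓ _)

theorem antitone_prod_cos_sq (γ : ℝ) :
    Antitone fun m : ℕ => ∏ j ∈ Finset.Icc 1 m, Real.cos (Real.pi * (γ / 2 ^ j)) ^ 2 := by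
  refine antitone_nat_of_succ_le fun m => ?_
  rw [Finset.prod_Icc_succ_top (by omega)]
  exact mul_le_of_le_one_right (Finset.prod_nonneg fun _ _ => sq_nonneg _) (Real.cos_sq_le_one _)

/-- Factors are removed from `j = n` downwards, singly or in pairs; the constant `poly α ℓ 1` pays
for a large factor left unpaired at `j = 1`. -/
theorem prod_poly_le_pow {α : ℝ} {ℓ : ℕ} (hα : 1 ≤ α) (hℓ : (ℓ : ℝ) ≤ α - 1 / 2) (γ : ℝ) (n : ℕ) :
    ∏ j ∈ Finset.Icc 1 n, poly α ℓ (Real.sin (Real.pi * (γ / 2 ^ j)) ^ 2) ≤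
      poly α ℓ 1 * poly α ℓ (3 / 4) ^ n := by
  have hα0 : 0 < α := by linarith
  have hM := one_le_poly hα0 ℓ (x := 3 / 4) (by norm_num)
  have h1 := one_le_poly hα0 ℓ (x := 1) (by norm_num)
  induction n using Nat.strong_induction_on with
  | _ n ih =>
    rcases n with _ | n
    · simpa using h1
    have hu0 := sq_nonneg (Real.sin (Real.pi * (γ / 2 ^ (n + 1))))
    have hu1 := Real.sin_sq_le_one (Real.pi * (γ / 2 ^ (n + 1)))
    rw [Finset.prod_Icc_succ_top (by omega)]
    rcases le_total (Real.sin (Real.pi * (γ / 2 ^ (n + 1))) ^ 2) (3 / 4) with hu | hu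
    · calc _ ≤ (poly α ℓ 1 * poly α ℓ (3 / 4) ^ n) * poly α ℓ (3 / 4) :=
          mul_le_mul (ih n (by omega)) (poly_mono hα0 ℓ hu0 hu)
            (zero_le_one.trans (one_le_poly_sin_sq hα ℓ _)) (by positivity)
        _ = _ := by ring
    · rcases n with _ | k
      · have := poly_mono hα0 ℓ hu0 hu1
        simp only [Finset.Icc_eq_empty_of_lt zero_lt_one, Finset.prod_empty, one_mul, zero_add,
          pow_one] at this ⊢
        exact this.trans (le_mul_of_one_le_right (by linarith) hM)
      · have e : Real.sin (Real.pi * (γ / 2 ^ (k + 1))) ^ 2 =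
            4 * Real.sin (Real.pi * (γ / 2 ^ (k + 1 + 1))) ^ 2 *
              (1 - Real.sin (Real.pi * (γ / 2 ^ (k + 1 + 1))) ^ 2) := by
          have e : Real.pi * (γ / 2 ^ (k + 1)) = 2 * (Real.pi * (γ / 2 ^ (k + 1 + 1))) := by
            rw [pow_succ _ (k + 1)]; field_simp
          rw [e, Real.sin_two_mul, ← Real.cos_sq']
          ring
        rw [Finset.prod_Icc_succ_top (by omega), mul_assoc, e,
          mul_comm (poly α ℓ (4 * _ * _))]
        calc _ ≤ (poly α ℓ 1 * poly α ℓ (3 / 4) ^ k) * poly α ℓ (3 / 4) ^ 2 := by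
              refine mul_le_mul (ih k (by omega)) (poly_mul_poly_le hα hℓ hu hu1) ?_
                (by positivity)
              rw [← e]
              exact mul_nonneg (zero_le_one.trans (one_le_poly_sin_sq hα ℓ _))
                (zero_le_one.trans (one_le_poly_sin_sq hα ℓ _))
          _ = _ := by ring

/-- Here `sin² ≤ π² 4^(-i)` at level `n + i`, and `1 + x ≤ exp x`. The exact partial geometric sum
lets the induction close. -/
theorem prod_poly_tail_le {α : ℝ} (hα : 1 ≤ α) (ℓ : ℕ) {γ : ℝ} {n : ℕ} (hγ : |γ| ≤ 2 ^ n) (m : ℕ) :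
    ∏ j ∈ Finset.Icc 1 (n + m), poly α ℓ (Real.sin (Real.pi * (γ / 2 ^ j)) ^ 2) ≤
      (∏ j ∈ Finset.Icc 1 n, poly α ℓ (Real.sin (Real.pi * (γ / 2 ^ j)) ^ 2)) *
        Real.exp (poly α ℓ 1 * Real.pi ^ 2 * ((1 - (1 / 4) ^ m) / 3)) := by
  have hα0 : 0 < α := by linarith
  have h1 := one_le_poly hα0 ℓ (x := 1) (by norm_num)
  have hpos : 0 ≤ ∏ j ∈ Finset.Icc 1 n,
      poly α ℓ (Real.sin (Real.pi * (γ / 2 ^ j)) ^ 2) :=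
    Finset.prod_nonneg fun _ _ => zero_le_one.trans (one_le_poly_sin_sq hα ℓ _)
  induction m with
  | zero => simp
  | succ m ih =>
    have hu0 := sq_nonneg (Real.sin (Real.pi * (γ / 2 ^ (n + m + 1))))
    have hu1 := Real.sin_sq_le_one (Real.pi * (γ / 2 ^ (n + m + 1)))
    have hu : Real.sin (Real.pi * (γ / 2 ^ (n + m + 1))) ^ 2 ≤
        Real.pi ^ 2 * (1 / 4) ^ (m + 1) := by
      have a : (γ / 2 ^ (n + m + 1)) ^ 2 ≤ (1 / 4) ^ (m + 1) := by
        have : γ ^ 2 ≤ (2 ^ n) ^ 2 := sq_le_sq' (by linarith [neg_abs_le γ])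
          ((le_abs_self γ).trans hγ)
        rw [div_pow, div_le_iff₀ (by positivity)]
        refine this.trans (le_of_eq ?_)
        rw [add_assoc, pow_add 2 n, mul_pow, ← pow_mul 2 (m + 1), mul_comm (m + 1) 2, pow_mul 2 2,
          mul_left_comm, ← mul_pow]
        norm_num
      calc _ ≤ (Real.pi * (γ / 2 ^ (n + m + 1))) ^ 2 := Real.sin_sq_le_sq
        _ = Real.pi ^ 2 * (γ / 2 ^ (n + m + 1)) ^ 2 := by ring
        _ ≤ _ := by gcongr
    have hfac : poly α ℓ (Real.sin (Real.pi * (γ / 2 ^ (n + m + 1))) ^ 2) ≤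
        Real.exp (poly α ℓ 1 * (Real.pi ^ 2 * (1 / 4) ^ (m + 1))) := by
      calc _ ≤ 1 + poly α ℓ 1 * Real.sin (Real.pi * (γ / 2 ^ (n + m + 1))) ^ 2 :=
            poly_le_one_add hα0 ℓ hu0 hu1
        _ ≤ poly α ℓ 1 * (Real.pi ^ 2 * (1 / 4) ^ (m + 1)) + 1 := by
            rw [add_comm]; gcongr
        _ ≤ _ := Real.add_one_le_exp _
    rw [← add_assoc, Finset.prod_Icc_succ_top (by omega)]
    calc _ ≤ _ := mul_le_mul ih hfac (zero_le_one.trans (one_le_poly_sin_sq hα ℓ _))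
          (mul_nonneg hpos (Real.exp_pos _).le)
      _ = _ := by
        rw [mul_assoc, ← Real.exp_add]
        congr 2
        ring

theorem exists_prod_poly_le {α : ℝ} {ℓ : ℕ} (hα : 1 ≤ α) (hℓ : (ℓ : ℝ) ≤ α - 1 / 2) :
    ∃ C : ℝ, 0 < C ∧ ∀ (m : ℕ) (γ : ℝ),
      ∏ j ∈ Finset.Icc 1 m, poly α ℓ (Real.sin (Real.pi * (γ / 2 ^ j)) ^ 2) ≤
        C * (1 + |γ|) ^ kappa α ℓ := by
  have hα0 : 0 < α := by linarith
  have h1 : 0 < poly α ℓ 1 := zero_lt_one.trans_le (one_le_poly hα0 ℓ (by norm_num))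
  refine ⟨poly α ℓ 1 * 2 ^ kappa α ℓ * Real.exp (poly α ℓ 1 * Real.pi ^ 2), by positivity,
    fun m γ => ?_⟩
  -- With `n = k + 1`, `2^n` is comparable to `1 + |γ|`, and `p(3/4)^n = (2^n)^κ`.
  obtain ⟨k, hk1, hk2⟩ := exists_nat_pow_near (show (1 : ℝ) ≤ 1 + |γ| by simp) one_lt_two
  set n := k + 1 with hn
  have hγ : |γ| ≤ 2 ^ n := by linarith
  have h2n : (2 : ℝ) ^ n ≤ 2 * (1 + |γ|) := by rw [hn, pow_succ]; linarith
  have hMn : poly α ℓ (3 / 4) ^ n ≤ 2 ^ kappa α ℓ * (1 + |γ|) ^ kappa α ℓ := by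
    rw [← two_rpow_kappa ℓ hα, ← Real.mul_rpow (by norm_num) (by positivity),
      ← Real.rpow_natCast, ← Real.rpow_mul (by norm_num), mul_comm (kappa α ℓ),
      Real.rpow_mul (by norm_num), Real.rpow_natCast]
    exact Real.rpow_le_rpow (by positivity) h2n (kappa_nonneg ℓ hα)
  have hexp : Real.exp (poly α ℓ 1 * Real.pi ^ 2 * ((1 - (1 / 4) ^ m) / 3)) ≤
      Real.exp (poly α ℓ 1 * Real.pi ^ 2) := by
    refine Real.exp_le_exp.2 (mul_le_of_le_one_right (by positivity) ?_)
    have : (0 : ℝ) ≤ (1 / 4) ^ m := by positivity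
    linarith
  calc _ ≤ _ := monotone_prod_poly hα ℓ γ (Nat.le_add_left m n)
    _ ≤ _ := prod_poly_tail_le hα ℓ hγ m
    _ ≤ (poly α ℓ 1 * (2 ^ kappa α ℓ * (1 + |γ|) ^ kappa α ℓ)) *
        Real.exp (poly α ℓ 1 * Real.pi ^ 2) := by
      refine mul_le_mul ((prod_poly_le_pow hα hℓ γ n).trans ?_) hexp (Real.exp_pos _).le
        (by positivity)
      gcongr
    _ = _ := by ring

theorem exists_norm_cascadeHat_le {α : ℝ} {ℓ : ℕ} (hα : 1 ≤ α) (hℓ : (ℓ : ℝ) ≤ α - 1 / 2) :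
    ∃ c : ℝ, 0 < c ∧ ∀ (m : ℕ) (γ : ℝ),
      ‖cascadeHat α ℓ m γ‖ ≤ c * (1 + |γ|) ^ (-2 * α + kappa α ℓ) := by
  obtain ⟨C, hC, hCb⟩ := exists_prod_poly_le hα hℓ
  refine ⟨(2 ^ 2) ^ α * C, by positivity, fun m γ => ?_⟩
  have hg : 0 < 1 + |γ| := by positivity
  by_cases hmem : γ ∈ Set.Icc (-((2 : ℝ) ^ m / 2)) ((2 : ℝ) ^ m / 2)
  · have hγ : |γ| ≤ 2 ^ m / 2 := abs_le.2 hmem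
    rw [cascadeHat, Set.indicator_of_mem hmem, Complex.norm_real, prod_filt_eq, norm_mul]
    have hc0 : 0 ≤ ∏ j ∈ Finset.Icc 1 m, Real.cos (Real.pi * (γ / 2 ^ j)) ^ 2 :=
      Finset.prod_nonneg fun _ _ => sq_nonneg _
    have hp0 : 0 ≤ ∏ j ∈ Finset.Icc 1 m, poly α ℓ (Real.sin (Real.pi * (γ / 2 ^ j)) ^ 2) :=
      Finset.prod_nonneg fun _ _ => zero_le_one.trans (one_le_poly_sin_sq hα ℓ _)
    rw [Real.norm_of_nonneg (Real.rpow_nonneg hc0 _), Real.norm_of_nonneg hp0]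
    have e : ((2 / (1 + |γ|)) ^ 2) ^ α = (2 ^ 2) ^ α * (1 + |γ|) ^ (-2 * α) := by
      rw [div_pow, Real.div_rpow (by positivity) (by positivity), neg_mul, Real.rpow_neg hg.le,
        Real.rpow_mul hg.le, div_eq_mul_inv, Real.rpow_two]
    calc _ ≤ ((2 / (1 + |γ|)) ^ 2) ^ α * (C * (1 + |γ|) ^ kappa α ℓ) :=
          mul_le_mul (Real.rpow_le_rpow hc0 (prod_cos_sq_le hγ) (by linarith)) (hCb m γ) hp0
            (by positivity)
      _ = _ := by rw [e, Real.rpow_add hg]; ring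
  · rw [cascadeHat, Set.indicator_of_notMem hmem, norm_zero]
    positivity

/-- The cosine product decreases and the polynomial product increases, both boundedly; the cutoff is
eventually inactive at `γ`. -/
theorem exists_tendsto_cascadeHat {α : ℝ} {ℓ : ℕ} (hα : 1 ≤ α) (hℓ : (ℓ : ℝ) ≤ α - 1 / 2) (γ : ℝ) :
    ∃ z : ℂ, Tendsto (fun m => cascadeHat α ℓ m γ) atTop (𝓝 z) := by
  obtain ⟨C, -, hCb⟩ := exists_prod_poly_le hα hℓ
  have hcos := tendsto_atTop_ciInf (antitone_prod_cos_sq γ)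
    ⟨0, by rintro _ ⟨m, rfl⟩; exact Finset.prod_nonneg fun _ _ => sq_nonneg _⟩
  have hpoly := tendsto_atTop_ciSup (monotone_prod_poly hα ℓ γ)
    ⟨C * (1 + |γ|) ^ kappa α ℓ, by rintro _ ⟨m, rfl⟩; exact hCb m γ⟩
  have hprod := (hcos.rpow_const (Or.inr (by linarith : 0 ≤ α))).mul hpoly
  simp only [← prod_filt_eq] at hprod
  refine ⟨_, ((Complex.continuous_ofReal.tendsto _).comp hprod).congr' ?_⟩
  have hlarge : ∀ᶠ m : ℕ in atTop, 2 * |γ| ≤ (2 : ℝ) ^ m :=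
    (tendsto_pow_atTop_atTop_of_one_lt one_lt_two).eventually_ge_atTop _
  filter_upwards [hlarge] with m hm
  rw [cascadeHat, Set.indicator_of_mem]
  · rfl
  · exact abs_le.1 (by linarith)

/-! ### From decay to Hölder regularity. -/

theorem integrable_rpow_mul_norm_of_decay {f : ℝ → ℂ} {c s t : ℝ}
    (hf : AEStronglyMeasurable f volume) (hb : ∀ x, ‖f x‖ ≤ c * (1 + |x|) ^ (-(s + 1)))
    (ht : 0 ≤ t) (hts : t < s) : Integrable fun x : ℝ => |x| ^ t * ‖f x‖ := by
  have hI : Integrable fun x : ℝ => c * (1 + ‖x‖) ^ (-(s + 1 - t)) :=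
    (integrable_one_add_norm (by simp; linarith)).const_mul c
  have hm : AEStronglyMeasurable (fun x : ℝ => |x| ^ t * ‖f x‖) volume :=
    (continuous_abs.rpow_const fun _ => Or.inr ht).aestronglyMeasurable.mul hf.norm
  refine hI.mono' hm (ae_of_all _ fun x => ?_)
  have hx : 0 < 1 + |x| := by positivity
  rw [Real.norm_of_nonneg (by positivity), Real.norm_eq_abs]
  calc |x| ^ t * ‖f x‖ ≤ (1 + |x|) ^ t * (c * (1 + |x|) ^ (-(s + 1))) :=
        mul_le_mul (Real.rpow_le_rpow (abs_nonneg x) (by linarith) ht) (hb x) (norm_nonneg _)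
          (by positivity)
    _ = c * (1 + |x|) ^ (-(s + 1 - t)) := by
        rw [mul_left_comm, ← Real.rpow_add hx]; ring_nf

theorem integrable_pow_smul_of_decay {f : ℝ → ℂ} {c s : ℝ} {n : ℕ}
    (hf : AEStronglyMeasurable f volume) (hb : ∀ x, ‖f x‖ ≤ c * (1 + |x|) ^ (-(s + 1)))
    (hn : (n : ℝ) < s) : Integrable fun x : ℝ => x ^ n • f x := by
  refine (integrable_rpow_mul_norm_of_decay hf hb (Nat.cast_nonneg n) hn).mono'
    ((continuous_pow n).aestronglyMeasurable.smul hf) (ae_of_all _ fun x => ?_)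
  rw [norm_smul, norm_pow, Real.norm_eq_abs, Real.rpow_natCast]

/-- Interpolation: the difference is at most `min(2, d)`, and this is at most `2 d^θ`. -/
theorem norm_fourierChar_sub_le {θ : ℝ} (h0 : 0 ≤ θ) (h1 : θ ≤ 1) (a b : ℝ) :
    ‖(Real.fourierChar a : ℂ) - Real.fourierChar b‖ ≤
      2 * (2 * Real.pi) ^ θ * |a - b| ^ θ := by
  have hp := Real.pi_pos
  have e : ‖(Real.fourierChar a : ℂ) - Real.fourierChar b‖ =
      ‖Complex.exp (Complex.I * ((2 * Real.pi * (a - b) : ℝ) : ℂ)) - 1‖ := by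
    have : (Real.fourierChar a : ℂ) - Real.fourierChar b = (Real.fourierChar b : ℂ) *
        (Complex.exp (Complex.I * ((2 * Real.pi * (a - b) : ℝ) : ℂ)) - 1) := by
      rw [Real.fourierChar_apply, Real.fourierChar_apply, mul_sub, ← Complex.exp_add, mul_one]
      congr 2
      push_cast
      ring
    rw [this, norm_mul, Circle.norm_coe, one_mul]
  have hle : ‖(Real.fourierChar a : ℂ) - Real.fourierChar b‖ ≤ 2 * Real.pi * |a - b| := by
    rw [e]
    refine Real.norm_exp_I_mul_ofReal_sub_one_le.trans (le_of_eq ?_)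
    rw [Real.norm_eq_abs, abs_mul, abs_of_pos (by positivity)]
  have hle2 : ‖(Real.fourierChar a : ℂ) - Real.fourierChar b‖ ≤ 2 := by
    refine (norm_sub_le _ _).trans (le_of_eq ?_)
    rw [Circle.norm_coe, Circle.norm_coe]; norm_num
  rw [mul_assoc, ← Real.mul_rpow (by positivity) (abs_nonneg _)]
  set d := 2 * Real.pi * |a - b| with hd
  have hd0 : 0 ≤ d := by positivity
  rcases le_total d 1 with h | h
  · have : d ^ (1 : ℝ) ≤ d ^ θ := Real.rpow_le_rpow_of_exponent_ge_of_imp hd0 h h1 (by simp)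
    rw [Real.rpow_one] at this
    linarith [Real.rpow_nonneg hd0 θ]
  · linarith [Real.one_le_rpow h h0]

theorem norm_fourier_sub_le {F : ℝ → ℂ} {θ : ℝ} (h0 : 0 ≤ θ) (h1 : θ ≤ 1) (hF : Integrable F)
    (hF' : Integrable fun v : ℝ => |v| ^ θ * ‖F v‖) (x y : ℝ) :
    ‖𝓕 F x - 𝓕 F y‖ ≤
      (2 * (2 * Real.pi) ^ θ * ∫ v : ℝ, |v| ^ θ * ‖F v‖) * |x - y| ^ θ := by
  have hint : ∀ w : ℝ, Integrable fun v : ℝ => Real.fourierChar (-(v * w)) • F v := fun w => by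
    have := (Real.fourierIntegral_convergent_iff (f := F) (μ := volume) w).2 hF
    refine this.congr (ae_of_all _ fun v => ?_)
    simp [mul_comm]
  rw [Real.fourier_real_eq, Real.fourier_real_eq, ← integral_sub (hint x) (hint y)]
  have hr : (2 * (2 * Real.pi) ^ θ * ∫ v : ℝ, |v| ^ θ * ‖F v‖) * |x - y| ^ θ =
      ∫ v : ℝ, (2 * (2 * Real.pi) ^ θ * |x - y| ^ θ) * (|v| ^ θ * ‖F v‖) := by
    rw [integral_const_mul]; ring
  rw [hr]
  refine norm_integral_le_of_norm_le (hF'.const_mul _) (ae_of_all _ fun v => ?_)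
  rw [Circle.smul_def, Circle.smul_def, ← sub_smul, norm_smul]
  have e : |-(v * x) - -(v * y)| ^ θ = |v| ^ θ * |x - y| ^ θ := by
    rw [← Real.mul_rpow (abs_nonneg _) (abs_nonneg _), ← abs_mul, ← abs_neg (v * (x - y))]
    ring_nf
  calc _ ≤ (2 * (2 * Real.pi) ^ θ * |-(v * x) - -(v * y)| ^ θ) * ‖F v‖ := by
        gcongr
        exact norm_fourierChar_sub_le h0 h1 _ _
    _ = _ := by rw [e]; ring

/-- A function dominated by `(1 + |x|) ^ (-(s + 1))` has a Fourier transform of class `C ^ r` for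
all `r < s`. -/
theorem isHolder_fourier_of_decay {f : ℝ → ℂ} {c s r : ℝ}
    (hf : AEStronglyMeasurable f volume) (hb : ∀ x, ‖f x‖ ≤ c * (1 + |x|) ^ (-(s + 1)))
    (hr0 : 0 ≤ r) (hrs : r < s) : IsHolder r (𝓕 f) := by
  have hfl : (⌊r⌋₊ : ℝ) ≤ r := Nat.floor_le hr0
  have hfl' : r < ⌊r⌋₊ + 1 := Nat.lt_floor_add_one r
  have hI : ∀ k : ℕ, k ≤ ⌊r⌋₊ → Integrable fun x : ℝ => x ^ k • f x := fun k hk =>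
    integrable_pow_smul_of_decay hf hb
      (((Nat.cast_le (α := ℝ)).2 hk).trans_lt (hfl.trans_lt hrs))
  have hD : ∀ k : ℕ, k ≤ ⌊r⌋₊ → iteratedDeriv k (𝓕 f) =
      𝓕 fun x : ℝ => (-2 * Real.pi * Complex.I * x) ^ k • f x := fun k hk =>
    Real.iteratedDeriv_fourier (N := (⌊r⌋₊ : ℕ))
      (fun n hn => hI n (by exact_mod_cast hn)) (by exact_mod_cast hk)
  refine ⟨?_, fun k hk => ?_, ?_⟩
  · refine Real.contDiff_fourier (N := (⌊r⌋₊ : ℕ)) fun n hn => ?_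
    simpa [norm_smul] using (hI n (by exact_mod_cast hn)).norm
  · rw [hD k hk]
    exact ⟨_, fun x => VectorFourier.norm_fourierIntegral_le_integral_norm _ _ _ _ x⟩
  · rw [hD _ le_rfl]
    refine ⟨_, norm_fourier_sub_le (sub_nonneg.2 hfl) (by linarith) ?_ ?_⟩
    · refine ((hI _ le_rfl).const_mul ((-2 * Real.pi * Complex.I : ℂ) ^ ⌊r⌋₊)).congr
        (ae_of_all _ fun v => ?_)
      simp only [mul_pow, smul_eq_mul, Complex.real_smul, Complex.ofReal_pow]
      ring
    · refine ((integrable_rpow_mul_norm_of_decay hf hb hr0 hrs).const_mul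
        ((2 * Real.pi) ^ ⌊r⌋₊)).congr (ae_of_all _ fun v => ?_)
      have e : |v| ^ r = |v| ^ (r - ⌊r⌋₊) * |v| ^ ⌊r⌋₊ := by
        rw [← Real.rpow_natCast, ← Real.rpow_add_of_nonneg (abs_nonneg v) (by linarith)
          (Nat.cast_nonneg _)]
        ring_nf
      simp only [e, norm_smul, norm_pow, norm_mul, norm_neg, Complex.norm_I, Complex.norm_real,
        Complex.norm_ofNat, Real.norm_eq_abs, abs_of_pos Real.pi_pos, mul_pow]
      ring

/-! ### The `L²` transform and the Fourier integral. -/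

theorem continuous_fourierInv {f : ℝ → ℂ} (hf : Integrable f) : Continuous (𝓕⁻ f) :=
  VectorFourier.fourierIntegral_continuous Real.continuous_fourierChar
    (by simp only [LinearMap.neg_apply, innerₗ_apply_apply]; fun_prop) hf

/-- The inverse Fourier transform on `L²` is given by the inverse Fourier integral for integrable
functions. -/
theorem fourierInv_Lp_ae_eq {u : Lp ℂ 2 (volume : Measure ℝ)} {f : ℝ → ℂ} (hf : Integrable f)
    (hu : (u : ℝ → ℂ) =ᵐ[volume] f) :
    ((𝓕⁻ u : Lp ℂ 2 (volume : Measure ℝ)) : ℝ → ℂ) =ᵐ[volume] 𝓕⁻ f := by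
  -- Smooth compactly supported test functions are Schwartz, so both transforms can be moved onto
  -- them by duality.
  refine ae_eq_of_integral_contDiff_smul_eq ((Lp.memLp _).locallyIntegrable (by norm_num))
    (continuous_fourierInv hf).locallyIntegrable fun g hg hgc => ?_
  have hg1 : HasCompactSupport (Complex.ofRealCLM ∘ g) := hgc.comp_left rfl
  have hg2 : ContDiff ℝ (⊤ : ℕ∞) (Complex.ofRealCLM ∘ g) := by fun_prop
  set G : SchwartzMap ℝ ℂ := hg1.toSchwartzMap hg2 with hG
  have hGa : ∀ x, G x = (g x : ℂ) := fun x => rfl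
  calc ∫ x, g x • (𝓕⁻ u : Lp ℂ 2 (volume : Measure ℝ)) x
      = Lp.toTemperedDistribution (𝓕⁻ u) G := by
        rw [Lp.toTemperedDistribution_apply]; rfl
    _ = Lp.toTemperedDistribution u (𝓕⁻ G) := by
        rw [← Lp.fourierInv_toTemperedDistribution_eq, TemperedDistribution.fourierInv_apply]
    _ = ∫ x, (𝓕⁻ G) x • f x := by
        rw [Lp.toTemperedDistribution_apply]
        refine integral_congr_ae ?_
        filter_upwards [hu] with x hx
        rw [hx]
    _ = ∫ x, G x • 𝓕⁻ f x := by
        rw [SchwartzMap.fourierInv_coe]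
        have := VectorFourier.integral_fourierIntegral_smul_eq_flip (μ := (volume : Measure ℝ))
          (ν := (volume : Measure ℝ)) (L := -innerₗ ℝ) (f := G) (g := f)
          Real.continuous_fourierChar
          (by simp only [LinearMap.neg_apply, innerₗ_apply_apply]; fun_prop)
          G.integrable hf
        have hflip : (-innerₗ ℝ : ℝ →ₗ[ℝ] ℝ →ₗ[ℝ] ℝ).flip = -innerₗ ℝ := by
          ext; simp
        rw [hflip] at this
        exact this
    _ = ∫ x, g x • 𝓕⁻ f x := rfl

/-- A subsequence of an `L²`-convergent sequence converges almost everywhere, which identifies the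
two limits. -/
theorem fourier_ae_eq_of_tendsto {α : ℝ} {ℓ : ℕ} {hα : 1 ≤ α} {φ : Lp ℂ 2 (volume : Measure ℝ)}
    (hφ : IsPseudoSpline ℓ hα φ) {φhat : ℝ → ℂ}
    (h : ∀ γ : ℝ, Tendsto (fun m => cascadeHat α ℓ m γ) atTop (𝓝 (φhat γ))) :
    ((𝓕 φ : Lp ℂ 2 (volume : Measure ℝ)) : ℝ → ℂ) =ᵐ[volume] φhat := by
  have hlim : Tendsto (fun m => (memLp_cascadeHat ℓ hα m).toLp (cascadeHat α ℓ m)) atTop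
      (𝓝 (𝓕 φ : Lp ℂ 2 (volume : Measure ℝ))) := by
    have := ((fourierCLM ℂ (Lp ℂ 2 (volume : Measure ℝ))).continuous.tendsto φ).comp hφ
    refine this.congr fun m => ?_
    simp [cascade]
  obtain ⟨ns, hns, hae⟩ := (tendstoInMeasure_of_tendsto_Lp hlim).exists_seq_tendsto_ae
  have hcoe : ∀ᵐ γ : ℝ, ∀ m, (memLp_cascadeHat ℓ hα m).toLp (cascadeHat α ℓ m) γ =
      cascadeHat α ℓ m γ := ae_all_iff.2 fun m => (memLp_cascadeHat ℓ hα m).coeFn_toLp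
  filter_upwards [hae, hcoe] with γ h1 h2
  simp only [h2] at h1
  exact tendsto_nhds_unique h1 ((h γ).comp hns.tendsto_atTop)

end FracPseudoSpline

theorem mainTheorem5 (α : ℝ) (ℓ : ℕ) (hα : 1 ≤ α) (hℓ : (ℓ : ℤ) ≤ ⌊α - 1 / 2⌋)
    (φ : Lp ℂ 2 (volume : Measure ℝ)) (hφ : FracPseudoSpline.IsPseudoSpline ℓ hα φ) :
    (∃ φhat : ℝ → ℂ,
      (∀ γ : ℝ, Tendsto (fun m => FracPseudoSpline.cascadeHat α ℓ m γ) atTop (𝓝 (φhat γ))) ∧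
      (𝓕 φ : Lp ℂ 2 (volume : Measure ℝ)) =ᵐ[volume] φhat ∧
      ∃ c : ℝ, 0 < c ∧ ∀ γ : ℝ,
        ‖φhat γ‖ ≤ c * (1 + |γ|) ^ (-2 * α + FracPseudoSpline.kappa α ℓ)) ∧
    0 < 2 * α - FracPseudoSpline.kappa α ℓ - 1 ∧
    ∃ g : ℝ → ℂ, (φ : ℝ → ℂ) =ᵐ[volume] g ∧
      ∀ ε : ℝ, 0 < ε → ε ≤ 2 * α - FracPseudoSpline.kappa α ℓ - 1 →
        FracPseudoSpline.IsHolder (2 * α - FracPseudoSpline.kappa α ℓ - 1 - ε) g := by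
  have hℓ' : (ℓ : ℝ) ≤ α - 1 / 2 := by exact_mod_cast Int.le_floor.1 hℓ
  choose φhat hlim using FracPseudoSpline.exists_tendsto_cascadeHat hα hℓ'
  obtain ⟨c, hc, hcb⟩ := FracPseudoSpline.exists_norm_cascadeHat_le hα hℓ'
  have hb : ∀ γ : ℝ, ‖φhat γ‖ ≤ c * (1 + |γ|) ^ (-2 * α + FracPseudoSpline.kappa α ℓ) := fun γ =>
    le_of_tendsto (hlim γ).norm (Eventually.of_forall fun m => hcb m γ)
  have hae := FracPseudoSpline.fourier_ae_eq_of_tendsto hφ hlim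
  have hs : 0 < 2 * α - FracPseudoSpline.kappa α ℓ - 1 := by
    linarith [FracPseudoSpline.kappa_lt hα hℓ']
  have hm : AEStronglyMeasurable φhat volume := (Lp.aestronglyMeasurable _).congr hae
  have hb' : ∀ γ : ℝ,
      ‖φhat γ‖ ≤ c * (1 + |γ|) ^ (-(2 * α - FracPseudoSpline.kappa α ℓ - 1 + 1)) := fun γ => by
    convert hb γ using 3
    ring
  have hint : Integrable φhat := by
    simpa using FracPseudoSpline.integrable_pow_smul_of_decay (n := 0) hm hb' (by simpa using hs)
  -- The representative `𝓕⁻ φhat` is fixed before `ε`.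
  refine ⟨⟨φhat, hlim, hae, c, hc, hb⟩, hs, 𝓕⁻ φhat, ?_, fun ε hε hε' => ?_⟩
  · have := FracPseudoSpline.fourierInv_Lp_ae_eq hint hae
    rwa [fourierInv_fourier_eq] at this
  · rw [Real.fourierInv_eq_fourier_comp_neg]
    exact FracPseudoSpline.isHolder_fourier_of_decay (hm.comp_quasiMeasurePreserving
      (Measure.measurePreserving_neg volume).quasiMeasurePreserving)
      (fun x => (hb' (-x)).trans_eq (by rw [abs_neg])) (by linarith) (by linarith)
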